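/- Let $p$ be a prime. All rings are commutative with unit. A $\delta$-ring is a ring $A$ with a map $\delta\colon A\to A$ such that $\delta(1)=0$, $\delta(xy)=x^p\delta(y)+\delta(x)y^p+p\,\delta(x)\delta(y)$ and $\delta(x+y)=\delta(x)+\delta(y)-\sum_{0<i<p}\frac1p\binom pi x^iy^{p-i}$ for all $x,y\in A$; morphisms of $\delta$-rings are ring homomorphisms commuting with $\delta$. A $\delta$-ring $A$ is called perfect if its Frobenius lift $\varphi(x)=x^p+p\,\delta(x)$ is bijective, and $p$-complete if $A\to\varprojlim_n A/p^nA$ is an isomorphism. For a perfect $\mathbb F_p$-algebra $R$, the ring $W(R)$ of $p$-typical Witt vectors is a $p$-complete perfect $\delta$-ring, whose Frobenius lift is the Witt vector Frobenius, and $W$ is a functor from perfect $\mathbb F_p$-algebras to $p$-complete perfect $\delta$-rings. A $p$-Boolean algebra is an $\mathbb F_p$-algebra $R$ with $a^p=a$ for all $a\in R$ (such an $R$ is perfect). Let $\mathrm{Stone}^{\delta,\wedge}$, the category of Stone $\delta$-rings, be the full subcategory of the category of $p$-complete perfect $\delta$-rings on the objects isomorphic to $W(R)$ for some $p$-Boolean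 algebra $R$. Let $\mathrm{ProFin}$ be the category of profinite sets (compact Hausdorff totally disconnected spaces) with continuous maps. **Theorem.** There exists an equivalence of categories $$(\mathrm{Stone}^{\delta,\wedge})^{\mathrm{op}}\simeq\mathrm{ProFin}.$$ -/

import Mathlib

universe u

open CategoryTheory

namespace StoneDelta

/-- A `δ`-structure (for the prime `p`) on a commutative ring `A`. -/
class DeltaRing (p : ℕ) (A : Type u) [CommRing A] where
  /-- The operation `δ : A → A`. -/
  delta : A → A
  delta_one : delta 1 = 0
  delta_mul : ∀ x y : A,
    delta (x * y) = x ^ p * delta y + delta x * y ^ p + (p : A) * delta x * delta y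
  /-- The subtracted sum is the value at `(x, y)` of the polynomial with integer coefficients
  `((X + Y) ^ p - X ^ p - Y ^ p) / p`; each `p.choose i / p` is an exact division. -/
  delta_add : ∀ x y : A,
    delta (x + y) = delta x + delta y -
      ∑ i ∈ Finset.Ioo 0 p, ((p.choose i / p : ℕ) : A) * (x ^ i * y ^ (p - i))

/-- The binomial formula, with `p` divided out of the mixed terms. -/
theorem add_pow_eq_add_mul_sum {p : ℕ} (hp : p.Prime) {A : Type u} [CommRing A] (x y : A) :
    (x + y) ^ p = x ^ p + y ^ p +
      (p : A) * ∑ i ∈ Finset.Ioo 0 p, ((p.choose i / p : ℕ) : A) * (x ^ i * y ^ (p - i)) := by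
  have hsum : (p : A) * ∑ i ∈ Finset.Ioo 0 p, ((p.choose i / p : ℕ) : A) * (x ^ i * y ^ (p - i))
      = ∑ i ∈ Finset.Ioo 0 p, x ^ i * y ^ (p - i) * (p.choose i : A) := by
    rw [Finset.mul_sum]
    refine Finset.sum_congr rfl fun i hi => ?_
    rw [Finset.mem_Ioo] at hi
    have hd : p * (p.choose i / p) = p.choose i :=
      Nat.mul_div_cancel' (hp.dvd_choose_self hi.1.ne' hi.2)
    rw [← mul_assoc, ← Nat.cast_mul, hd, mul_comm]
  have hIco : Finset.Ico 1 p = Finset.Ioo 0 p := by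
    ext i
    simp only [Finset.mem_Ico, Finset.mem_Ioo]
    omega
  rw [hsum, add_pow, Finset.sum_range_succ, Finset.range_eq_Ico,
    Finset.sum_eq_sum_Ico_succ_bot hp.pos, zero_add, hIco]
  simp
  ring

theorem DeltaRing.delta_zero (p : ℕ) (A : Type u) [CommRing A] [DeltaRing p A] :
    DeltaRing.delta p (0 : A) = 0 := by
  have h := DeltaRing.delta_add (p := p) (0 : A) 0
  have hs : ∑ i ∈ Finset.Ioo 0 p, ((p.choose i / p : ℕ) : A) * ((0 : A) ^ i * 0 ^ (p - i)) = 0 := by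
    refine Finset.sum_eq_zero fun i hi => ?_
    rw [Finset.mem_Ioo] at hi
    rw [zero_pow hi.1.ne', zero_mul, mul_zero]
  rw [hs, add_zero, sub_zero] at h
  simpa using h

/-- The Frobenius lift `φ(x) = x ^ p + p δ(x)` of a `δ`-ring. -/
def frobeniusLift (p : ℕ) [hp : Fact p.Prime] (A : Type u) [CommRing A] [DeltaRing p A] :
    A →+* A where
  toFun x := x ^ p + (p : A) * DeltaRing.delta p x
  map_one' := by rw [DeltaRing.delta_one, one_pow, mul_zero, add_zero]
  map_mul' x y := by rw [DeltaRing.delta_mul]; ring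
  map_zero' := by rw [DeltaRing.delta_zero, zero_pow hp.out.ne_zero, mul_zero, add_zero]
  map_add' x y := by rw [DeltaRing.delta_add, add_pow_eq_add_mul_sum hp.out]; ring

/-- A bundled (commutative) `δ`-ring. -/
structure DeltaRingCat (p : ℕ) where
  carrier : Type u
  [commRing : CommRing carrier]
  [deltaRing : DeltaRing p carrier]

attribute [instance] DeltaRingCat.commRing DeltaRingCat.deltaRing

instance (p : ℕ) : CoeSort (DeltaRingCat.{u} p) (Type u) := ⟨DeltaRingCat.carrier⟩

/-- A morphism of `δ`-rings: a ring homomorphism commuting with `δ`. -/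
@[ext]
structure DeltaRingCat.Hom {p : ℕ} (A B : DeltaRingCat.{u} p) where
  toRingHom : A →+* B
  map_delta : ∀ x : A, toRingHom (DeltaRing.delta p x) = DeltaRing.delta p (toRingHom x)

/-- The category of `δ`-rings. -/
instance (p : ℕ) : Category (DeltaRingCat.{u} p) where
  Hom A B := DeltaRingCat.Hom A B
  id A := ⟨RingHom.id A, fun _ => rfl⟩
  comp f g := ⟨g.toRingHom.comp f.toRingHom, fun x => by
    simp only [RingHom.comp_apply, f.map_delta, g.map_delta]⟩

/-- The category of `p`-complete perfect `δ`-rings, as a full subcategory of `δ`-rings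
(a ring homomorphism is automatically continuous for the `p`-adic topologies). -/
abbrev PerfDeltaRingCat (p : ℕ) [Fact p.Prime] :=
  ObjectProperty.FullSubcategory fun A : DeltaRingCat.{u} p =>
    IsAdicComplete (Ideal.span {(p : A)}) A ∧ Function.Bijective (frobeniusLift p A)

/-- The category of perfect commutative `𝔽_p`-algebras, those for which `a ↦ a ^ p` is
bijective. -/
abbrev PerfAlgCat (p : ℕ) :=
  ObjectProperty.FullSubcategory fun R : CommAlgCat.{u} (ZMod p) => PerfectRing R p

/-- The category of `p`-Boolean algebras: commutative `𝔽_p`-algebras with `a ^ p = a`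
for all `a`. -/
abbrev PBoolCat (p : ℕ) :=
  ObjectProperty.FullSubcategory fun R : CommAlgCat.{u} (ZMod p) => ∀ a : R, a ^ p = a

/-- Every `p`-Boolean algebra is perfect. -/
def PBoolCat.toPerfAlgCat (p : ℕ) : PBoolCat.{u} p ⥤ PerfAlgCat.{u} p :=
  ObjectProperty.ιOfLE fun R h => ⟨by
    have : (fun x : R => x ^ p) = id := funext h
    rw [this]
    exact Function.bijective_id⟩

section Witt

variable (p : ℕ) [hp : Fact p.Prime] (R : Type u) [CommRing R] [Algebra (ZMod p) R]
  [PerfectRing R p]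

/-- Witt vectors of a perfect `𝔽_p`-algebra (possibly zero): no `p`-torsion,
`p`-adically complete, and the Witt vector Frobenius is an automorphism lifting the
`p`-th power map modulo `p`. -/
theorem witt_facts :
    (∀ x y : WittVector p R, (p : WittVector p R) * x = p * y → x = y) ∧
    (∀ x : WittVector p R, ∃ y, WittVector.frobenius x = x ^ p + (p : WittVector p R) * y) ∧
    IsAdicComplete (Ideal.span {(p : WittVector p R)}) (WittVector p R) ∧
    Function.Bijective (WittVector.frobenius : WittVector p R →+* WittVector p R) := by
  rcases subsingleton_or_nontrivial R with h | h
  · have hs : Subsingleton (WittVector p R) :=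
      ⟨fun x y => WittVector.ext fun n => Subsingleton.elim _ _⟩
    exact ⟨fun _ _ _ => Subsingleton.elim _ _, fun _ => ⟨0, Subsingleton.elim _ _⟩,
      inferInstance, Function.injective_of_subsingleton _, fun y => ⟨y, Subsingleton.elim _ _⟩⟩
  · have : CharP R p := charP_of_injective_algebraMap (algebraMap (ZMod p) R).injective p
    refine ⟨fun x y hxy => ?_, fun x => ?_, inferInstance, WittVector.frobenius_bijective p R⟩
    · rw [← sub_eq_zero]
      apply WittVector.eq_zero_of_p_mul_eq_zero
      rw [sub_mul, mul_comm x, mul_comm y, hxy, sub_self]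
    · have hx : WittVector.frobenius x - x ^ p ∈ Ideal.span {(p : WittVector p R)} := by
        rw [WittVector.mem_span_p_iff_coeff_zero_eq_zero, ← WittVector.constantCoeff_apply,
          map_sub, map_pow, WittVector.constantCoeff_apply, WittVector.constantCoeff_apply,
          WittVector.coeff_frobenius_charP, sub_self]
      obtain ⟨y, hy⟩ := Ideal.mem_span_singleton'.mp hx
      exact ⟨y, by rw [mul_comm, hy]; ring⟩

/-- The `δ`-structure on the `p`-typical Witt vectors of a perfect `𝔽_p`-algebra: the unique one
whose Frobenius lift is the Witt vector Frobenius, i.e. `F x = x ^ p + p δ(x)`. -/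
noncomputable def wittDelta (x : WittVector p R) : WittVector p R :=
  ((witt_facts p R).2.1 x).choose

theorem wittDelta_spec (x : WittVector p R) :
    WittVector.frobenius x = x ^ p + (p : WittVector p R) * wittDelta p R x :=
  ((witt_facts p R).2.1 x).choose_spec

noncomputable instance wittDeltaRing : DeltaRing p (WittVector p R) where
  delta := wittDelta p R
  delta_one := by
    apply (witt_facts p R).1
    have h := wittDelta_spec p R 1
    rw [map_one, one_pow] at h
    linear_combination -h
  delta_mul x y := by
    apply (witt_facts p R).1
    have h := wittDelta_spec p R (x * y)
    rw [map_mul, wittDelta_spec p R x, wittDelta_spec p R y] at h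
    linear_combination -h
  delta_add x y := by
    apply (witt_facts p R).1
    have h := wittDelta_spec p R (x + y)
    rw [map_add, wittDelta_spec p R x, wittDelta_spec p R y,
      add_pow_eq_add_mul_sum hp.out x y] at h
    linear_combination -h

theorem frobeniusLift_witt :
    frobeniusLift p (WittVector p R) = WittVector.frobenius :=
  RingHom.ext fun x => (wittDelta_spec p R x).symm

end Witt

theorem map_wittDelta (p : ℕ) [Fact p.Prime] {R S : Type u} [CommRing R] [Algebra (ZMod p) R]
    [PerfectRing R p] [CommRing S] [Algebra (ZMod p) S] [PerfectRing S p] (f : R →+* S)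
    (x : WittVector p R) :
    WittVector.map f (wittDelta p R x) = wittDelta p S (WittVector.map f x) := by
  have hF : WittVector.map f (WittVector.frobenius x) =
      WittVector.frobenius (WittVector.map f x) := by
    ext n
    rw [WittVector.map_coeff, WittVector.coeff_frobenius, WittVector.coeff_frobenius,
      MvPolynomial.map_aeval, RingHom.ext_int (f.comp (algebraMap ℤ R)) (algebraMap ℤ S)]
    rfl
  apply (witt_facts p S).1
  rw [wittDelta_spec, wittDelta_spec, map_add, map_mul, map_pow, map_natCast] at hF
  linear_combination hF

/-- The Witt vector functor from perfect `𝔽_p`-algebras to `p`-complete perfect `δ`-rings. -/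
noncomputable def wittFunctor (p : ℕ) [Fact p.Prime] :
    PerfAlgCat.{u} p ⥤ PerfDeltaRingCat.{u} p where
  obj R :=
    have : PerfectRing R.obj p := R.property
    { obj := { carrier := WittVector p R.obj }
      property := ⟨(witt_facts p R.obj).2.2.1, by
        rw [frobeniusLift_witt]
        exact (witt_facts p R.obj).2.2.2⟩ }
  map {R S} f :=
    have : PerfectRing R.obj p := R.property
    have : PerfectRing S.obj p := S.property
    ObjectProperty.homMk
      { toRingHom := WittVector.map f.hom.hom.toRingHom
        map_delta := map_wittDelta p f.hom.hom.toRingHom }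
  map_id R := by
    apply ObjectProperty.hom_ext
    exact DeltaRingCat.Hom.ext (WittVector.map_id _)
  map_comp f g := by
    apply ObjectProperty.hom_ext
    refine DeltaRingCat.Hom.ext (RingHom.ext fun x => WittVector.ext fun n => ?_)
    rfl

/-- The category of Stone `δ`-rings: the essential image of the Witt vector functor from
`p`-Boolean algebras to `p`-complete perfect `δ`-rings, as a full subcategory of the latter. -/
abbrev StoneDeltaRingCat (p : ℕ) [Fact p.Prime] :=
  (PBoolCat.toPerfAlgCat.{u} p ⋙ wittFunctor.{u} p).EssImageSubcategory

end StoneDelta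

/-!
The equivalence is the composite of the Witt vector functor with Stone duality for `p`-Boolean
algebras.

*Witt vectors.* On perfect `𝔽_p`-algebras the functor `W` is fully faithful, even with arbitrary
ring homomorphisms `W(R) → W(S)` as morphisms. Reduction modulo `p` turns such a map into a
homomorphism `R → S`, and it is determined by this reduction (`wittVector_ringHom_ext`): if two maps
agree modulo `p`, then their values on the Teichmüller lift of `r = s ^ (p ^ n)` are
`p ^ n`-th powers of elements congruent modulo `p`, hence congruent modulo `p ^ (n + 1)`; and
Teichmüller lifts determine a map modulo every power of `p`. Hence `W` identifies `p`-Boolean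
algebras with its essential image, the Stone `δ`-rings.

*Stone duality.* A profinite set `X` is sent to the `p`-Boolean algebra of locally constant functions
`X → 𝔽_p`. By compactness of `X` every character of this algebra is the evaluation at a point
(`exists_forall_apply_eq_eval`), which gives full faithfulness. Conversely, a `p`-Boolean algebra
`R` is isomorphic to the algebra of locally constant functions on its space of characters through
the Gelfand transform: the residue fields of `R` are all `𝔽_p`, so every proper ideal is killed by
some character, and both injectivity and surjectivity follow from this by showing that a suitable
ideal is the whole of `R` (`CharSpace.gelfand_injective`, `CharSpace.gelfand_surjective`).
-/

namespace StoneDelta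

theorem charP_of_nontrivial_zmodAlgebra (p : ℕ) [Fact p.Prime] (R : Type*) [CommRing R]
    [Algebra (ZMod p) R] [Nontrivial R] : CharP R p :=
  charP_of_injective_algebraMap (algebraMap (ZMod p) R).injective p

/-! ### Full faithfulness of the Witt vector functor -/

section Witt

variable {p : ℕ} [hp : Fact p.Prime] {R S : Type*} [CommRing R] [Algebra (ZMod p) R]
  [PerfectRing R p] [CommRing S] [Algebra (ZMod p) S] [PerfectRing S p]

/-- A ring homomorphism between Witt vectors of perfect `𝔽_p`-algebras is determined by its
reduction modulo `p`. -/
theorem wittVector_ringHom_ext {f g : WittVector p R →+* WittVector p S}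
    (h : ∀ x, (f x).coeff 0 = (g x).coeff 0) : f = g := by
  rcases subsingleton_or_nontrivial S with hS | hS
  · exact RingHom.ext fun x => WittVector.ext fun n => Subsingleton.elim _ _
  have hR : Nontrivial R := by
    by_contra hR
    rw [not_nontrivial_iff_subsingleton] at hR
    have : (0 : WittVector p R) = 1 := WittVector.ext fun n => Subsingleton.elim _ _
    have := congrArg f this
    rw [map_zero, map_one] at this
    exact zero_ne_one this
  have := charP_of_nontrivial_zmodAlgebra p R
  have := charP_of_nontrivial_zmodAlgebra p S
  have key : ∀ n : ℕ, ∀ x,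
      f x - g x ∈ (Ideal.span {(p : WittVector p S)} ^ (n + 1) : Ideal (WittVector p S)) := by
    intro n x
    rw [← Ideal.Quotient.eq]
    refine RingHom.congr_fun (WittVector.eq_of_apply_teichmuller_eq
      ((Ideal.Quotient.mk _).comp f) ((Ideal.Quotient.mk _).comp g) ⟨n + 1, ?_⟩ fun r => ?_) x
    · rw [← map_natCast (Ideal.Quotient.mk _), ← map_pow, Ideal.Quotient.eq_zero_iff_mem]
      exact Ideal.pow_mem_pow (Ideal.mem_span_singleton_self _) _
    -- As `r` is a `p ^ n`-th power, congruence modulo `p` improves to modulo `p ^ (n + 1)`.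
    · obtain ⟨s, rfl⟩ := (bijective_iterateFrobenius R p (n := n)).2 r
      rw [iterateFrobenius_def, map_pow, RingHom.comp_apply, RingHom.comp_apply,
        Ideal.Quotient.eq, map_pow, map_pow, Ideal.span_singleton_pow,
        Ideal.mem_span_singleton]
      apply dvd_sub_pow_of_dvd_sub
      rw [← Ideal.mem_span_singleton, WittVector.mem_span_p_iff_coeff_zero_eq_zero,
        ← WittVector.constantCoeff_apply, map_sub, WittVector.constantCoeff_apply,
        WittVector.constantCoeff_apply, h, sub_self]
  ext x n
  have h1 := key n x
  rw [Ideal.span_singleton_pow, WittVector.mem_span_p_pow_iff_le_coeff_eq_zero,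
    ← WittVector.le_coeff_eq_iff_le_sub_coeff_eq_zero] at h1
  exact h1 n n.lt_succ_self

/-- Every ring homomorphism between Witt vectors of perfect `𝔽_p`-algebras is functorially induced,
namely by its reduction modulo `p`. -/
theorem exists_wittVector_map_eq (g : WittVector p R →+* WittVector p S) :
    ∃ f : R →+* S, WittVector.map f = g := by
  have hker : RingHom.ker (WittVector.constantCoeff : WittVector p R →+* R) ≤
      RingHom.ker (WittVector.constantCoeff.comp g) := by
    rcases subsingleton_or_nontrivial S with hS | hS
    · exact fun x _ => Subsingleton.elim _ _
    have := charP_of_nontrivial_zmodAlgebra p S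
    rcases subsingleton_or_nontrivial R with hR | hR
    · intro x _
      have : x = 0 := WittVector.ext fun n => Subsingleton.elim _ _
      rw [this]
      exact zero_mem _
    have := charP_of_nontrivial_zmodAlgebra p R
    rw [WittVector.ker_constantCoeff, Ideal.span_singleton_le_iff_mem, RingHom.mem_ker, map_natCast,
      CharP.cast_eq_zero]
  let f : R →+* S := RingHom.liftOfRightInverse WittVector.constantCoeff
    (WittVector.teichmuller p) (fun r => WittVector.teichmuller_coeff_zero p r) ⟨_, hker⟩
  refine ⟨f, wittVector_ringHom_ext fun x => ?_⟩
  rw [WittVector.map_coeff]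
  exact RingHom.liftOfRightInverse_comp_apply _ _ _ ⟨_, hker⟩ x

end Witt

instance (p : ℕ) [Fact p.Prime] : (wittFunctor.{u} p).Faithful where
  map_injective {R S} f g h := by
    have : PerfectRing R.obj p := R.property
    have : PerfectRing S.obj p := S.property
    apply ObjectProperty.hom_ext
    apply CommAlgCat.hom_ext
    ext r
    have h1 : WittVector.map f.hom.hom.toRingHom = WittVector.map g.hom.hom.toRingHom :=
      congrArg (fun k => k.hom.toRingHom) h
    have h2 := congrArg (fun w => w.coeff 0) (RingHom.congr_fun h1 (WittVector.teichmuller p r))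
    simpa [WittVector.map_coeff] using h2

instance (p : ℕ) [Fact p.Prime] : (wittFunctor.{u} p).Full where
  map_surjective {R S} g := by
    have : PerfectRing R.obj p := R.property
    have : PerfectRing S.obj p := S.property
    obtain ⟨f, hf⟩ := exists_wittVector_map_eq (R := R.obj) (S := S.obj) g.hom.toRingHom
    refine ⟨ObjectProperty.homMk (CommAlgCat.ofHom
      { f with commutes' := RingHom.congr_fun (RingHom.ext_zmod
        (f.comp (algebraMap (ZMod p) R.obj)) (algebraMap (ZMod p) S.obj)) }), ?_⟩
    apply ObjectProperty.hom_ext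
    exact DeltaRingCat.Hom.ext hf

instance (p : ℕ) : (PBoolCat.toPerfAlgCat.{u} p).Full :=
  inferInstanceAs (ObjectProperty.ιOfLE _).Full

instance (p : ℕ) : (PBoolCat.toPerfAlgCat.{u} p).Faithful :=
  inferInstanceAs (ObjectProperty.ιOfLE _).Faithful

/-! ### Characters of `p`-Boolean algebras -/

section Characters

open Topology

variable (p : ℕ) [hp : Fact p.Prime]

/-- The set of characters of an `𝔽_p`-algebra `R`, that is, of `𝔽_p`-algebra homomorphisms
`R → 𝔽_p`. It carries the topology of pointwise convergence. -/
def CharSpace (R : Type*) [CommRing R] [Algebra (ZMod p) R] := R →ₐ[ZMod p] ZMod p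

namespace CharSpace

variable {p} {R : Type*} [CommRing R] [Algebra (ZMod p) R]

instance : FunLike (CharSpace p R) R (ZMod p) := inferInstanceAs (FunLike (R →ₐ[ZMod p] ZMod p) _ _)

instance : AlgHomClass (CharSpace p R) (ZMod p) R (ZMod p) :=
  inferInstanceAs (AlgHomClass (R →ₐ[ZMod p] ZMod p) _ _ _)

instance : TopologicalSpace (CharSpace p R) :=
  TopologicalSpace.induced (fun x : CharSpace p R => (x : R → ZMod p)) inferInstance

theorem isClosedEmbedding_coe :
    IsClosedEmbedding (fun x : CharSpace p R => (x : R → ZMod p)) where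
  eq_induced := rfl
  injective := DFunLike.coe_injective
  isClosed_range := by
    have hrange : Set.range (fun x : CharSpace p R => (x : R → ZMod p)) =
        {f | (∀ c, f (algebraMap (ZMod p) R c) = c) ∧ (∀ a b, f (a * b) = f a * f b) ∧
          ∀ a b, f (a + b) = f a + f b} := by
      ext f
      constructor
      · rintro ⟨x, rfl⟩
        exact ⟨fun c => AlgHomClass.commutes x c, map_mul x, map_add x⟩
      · rintro ⟨hc, hm, ha⟩
        exact ⟨(({ toFun := f, map_one' := by simpa using hc 1, map_mul' := hm
                   map_zero' := by simpa using hc 0, map_add' := ha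
                   commutes' := hc } : R →ₐ[ZMod p] ZMod p) : CharSpace p R), rfl⟩
    rw [hrange]
    simp only [Set.ofPred_and, Set.ofPred_forall]
    refine .inter (isClosed_iInter fun c => isClosed_eq ?_ ?_)
      (.inter (isClosed_iInter fun a => isClosed_iInter fun b => isClosed_eq ?_ ?_)
        (isClosed_iInter fun a => isClosed_iInter fun b => isClosed_eq ?_ ?_)) <;> fun_prop

instance : CompactSpace (CharSpace p R) := isClosedEmbedding_coe.compactSpace

instance : T2Space (CharSpace p R) := isClosedEmbedding_coe.isEmbedding.t2Space

instance : TotallyDisconnectedSpace (CharSpace p R) :=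
  isClosedEmbedding_coe.isEmbedding.isTotallyDisconnected_range.mp
    (isTotallyDisconnected_of_totallyDisconnectedSpace _)

theorem continuous_apply (r : R) : Continuous fun x : CharSpace p R => x r :=
  (_root_.continuous_apply r).comp isClosedEmbedding_coe.continuous

/-- The sets `{y | y e ≠ 0}` form a basis of the topology: by Fermat's little theorem, a condition
on finitely many values of a character can be expressed through a single element. -/
theorem exists_apply_ne_zero_of_mem_nhds {x : CharSpace p R} {U : Set (CharSpace p R)}
    (hU : U ∈ 𝓝 x) : ∃ e : R, x e ≠ 0 ∧ ∀ y : CharSpace p R, y e ≠ 0 → y ∈ U := by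
  rw [nhds_induced, nhds_pi] at hU
  obtain ⟨V, hV, hVU⟩ := hU
  obtain ⟨I, t, ht, htV⟩ := Filter.mem_pi'.mp hV
  -- By Fermat, the factor for `i` is sent by `y` to `1` if `y i = x i` and to `0` otherwise.
  refine ⟨∏ i ∈ I, (1 - (i - algebraMap (ZMod p) R (x i)) ^ (p - 1)), ?_, fun y hy => ?_⟩
  · rw [map_prod, Finset.prod_ne_zero_iff]
    intro i _
    simp [AlgHomClass.commutes, Nat.sub_ne_zero_of_lt hp.out.one_lt]
  · rw [map_prod, Finset.prod_ne_zero_iff] at hy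
    refine hVU (htV fun i hi => ?_)
    have hyi : y i = x i := by
      by_contra hne
      refine hy i hi ?_
      rw [map_sub, map_pow, map_sub, AlgHomClass.commutes, map_one, Algebra.algebraMap_self_apply,
        ZMod.pow_card_sub_one_eq_one (sub_ne_zero.mpr hne), sub_self]
    change y i ∈ t i
    rw [hyi]
    exact mem_of_mem_nhds (ht i)

/-- In a `p`-Boolean algebra every proper ideal is contained in the kernel of a character: the
residue fields satisfy `a ^ p = a`, so they are `𝔽_p`. -/
theorem exists_forall_mem_apply_eq_zero (hR : ∀ a : R, a ^ p = a) {I : Ideal R} (hI : I ≠ ⊤) :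
    ∃ x : CharSpace p R, ∀ r ∈ I, x r = 0 := by
  obtain ⟨M, hM, hIM⟩ := I.exists_le_maximal hI
  let := Ideal.Quotient.field M
  have := charP_of_nontrivial_zmodAlgebra p (R ⧸ M)
  have hbij : Function.Bijective (algebraMap (ZMod p) (R ⧸ M)) := by
    refine ⟨(algebraMap (ZMod p) (R ⧸ M)).injective, fun a => ?_⟩
    have ha : a ^ p = a := by
      obtain ⟨a, rfl⟩ := Ideal.Quotient.mk_surjective a
      rw [← map_pow, hR]
    rw [← Subfield.mem_bot_iff_pow_eq_self (R ⧸ M) p] at ha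
    have hle : (⊥ : Subfield (R ⧸ M)) ≤ (algebraMap (ZMod p) (R ⧸ M)).fieldRange := bot_le
    exact hle ha
  refine ⟨((AlgEquiv.ofBijective (Algebra.ofId (ZMod p) (R ⧸ M)) hbij).symm.toAlgHom.comp
    (Ideal.Quotient.mkₐ (ZMod p) M) : R →ₐ[ZMod p] ZMod p), fun r hr => ?_⟩
  have h0 : Ideal.Quotient.mkₐ (ZMod p) M r = 0 := Ideal.Quotient.eq_zero_iff_mem.mpr (hIM hr)
  change (AlgEquiv.ofBijective (Algebra.ofId (ZMod p) (R ⧸ M)) hbij).symm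
    (Ideal.Quotient.mkₐ (ZMod p) M r) = 0
  rw [h0, map_zero]

variable (p R) in
/-- The Gelfand transform: an element `r` is sent to the function `x ↦ x r` on characters. -/
def gelfand : R →ₐ[ZMod p] LocallyConstant (CharSpace p R) (ZMod p) where
  toFun r := ⟨fun x => x r, (IsLocallyConstant.iff_continuous _).mpr (continuous_apply r)⟩
  map_one' := LocallyConstant.ext fun x => map_one x
  map_zero' := LocallyConstant.ext fun x => map_zero x
  map_mul' a b := LocallyConstant.ext fun x => map_mul x a b
  map_add' a b := LocallyConstant.ext fun x => map_add x a b
  commutes' c := LocallyConstant.ext fun x => AlgHomClass.commutes x c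

@[simp]
theorem gelfand_apply (r : R) (x : CharSpace p R) : gelfand p R r x = x r := rfl

theorem gelfand_injective (hR : ∀ a : R, a ^ p = a) : Function.Injective (gelfand p R) := by
  rw [injective_iff_map_eq_zero]
  intro r hr
  by_contra hne
  -- The annihilator of `r` is proper, yet no character vanishes on `1 - r ^ (p - 1)`.
  let I : Ideal R := LinearMap.ker (LinearMap.toSpanSingleton R R r)
  have hmem : ∀ s, s ∈ I ↔ s * r = 0 := fun s => by simp [I]
  have hI : I ≠ ⊤ := by
    rw [Ideal.ne_top_iff_one, hmem, one_mul]
    exact hne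
  obtain ⟨x, hx⟩ := exists_forall_mem_apply_eq_zero hR hI
  have h1 : 1 - r ^ (p - 1) ∈ I := by
    rw [hmem, sub_mul, ← pow_succ, Nat.sub_add_cancel hp.out.one_le, hR, one_mul, sub_self]
  have hxr : x r = 0 := LocallyConstant.congr_fun hr x
  have h2 := hx _ h1
  rw [map_sub, map_one, map_pow, hxr, zero_pow (Nat.sub_ne_zero_of_lt hp.out.one_lt),
    sub_zero] at h2
  exact one_ne_zero h2

theorem gelfand_surjective (hR : ∀ a : R, a ^ p = a) : Function.Surjective (gelfand p R) := by
  intro f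
  -- The `r` for which `r f` is a Gelfand transform form an ideal, on which no character vanishes.
  let I : Ideal R :=
    { carrier := {r | ∃ s, gelfand p R s = gelfand p R r * f}
      zero_mem' := ⟨0, by simp⟩
      add_mem' := by
        rintro a b ⟨s, hs⟩ ⟨t, ht⟩
        exact ⟨s + t, by rw [map_add, map_add, add_mul, hs, ht]⟩
      smul_mem' := by
        rintro c a ⟨s, hs⟩
        exact ⟨c * s, by rw [smul_eq_mul, map_mul, map_mul, mul_assoc, hs]⟩ }
  have hI : I = ⊤ := by
    by_contra hI
    obtain ⟨x, hx⟩ := exists_forall_mem_apply_eq_zero hR hI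
    obtain ⟨e, hxe, he⟩ := exists_apply_ne_zero_of_mem_nhds (f.isLocallyConstant.eventually_eq x)
    -- `f` is constant on the support of the transform of `e`, so that `e` lies in the ideal.
    refine hxe (hx e ⟨e * algebraMap (ZMod p) R (f x), LocallyConstant.ext fun y => ?_⟩)
    rw [gelfand_apply, map_mul, AlgHomClass.commutes, LocallyConstant.mul_apply, gelfand_apply,
      Algebra.algebraMap_self_apply]
    by_cases hy : y e = 0
    · rw [hy, zero_mul, zero_mul]
    · rw [show f y = f x from he y hy]
  obtain ⟨s, hs⟩ : (1 : R) ∈ I := hI ▸ Submodule.mem_top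
  exact ⟨s, by rw [hs, map_one, one_mul]⟩

end CharSpace

end Characters

/-! ### Algebras of locally constant functions -/

section LocallyConstant

variable {p : ℕ} [hp : Fact p.Prime] {X Y : Type*} [TopologicalSpace X] [TopologicalSpace Y]

theorem locallyConstant_pow_eq_self (f : LocallyConstant X (ZMod p)) : f ^ p = f :=
  LocallyConstant.ext fun x => ZMod.pow_card (f x)

/-- On a compact space, every character of the algebra of locally constant functions is the
evaluation at a point. -/
theorem exists_forall_apply_eq_eval [CompactSpace Y]
    (φ : LocallyConstant Y (ZMod p) →ₐ[ZMod p] ZMod p) : ∃ y, ∀ f, φ f = f y := by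
  by_contra! h
  choose f hf using h
  -- `g y` lies in the kernel of `φ` and does not vanish at `y`.
  let g (y : Y) : LocallyConstant Y (ZMod p) := f y - algebraMap (ZMod p) _ (φ (f y))
  have hφg : ∀ y, φ (g y) = 0 := fun y => by simp [g, AlgHomClass.commutes]
  have hg : ∀ y, g y y ≠ 0 := fun y => sub_ne_zero.mpr (hf y).symm
  obtain ⟨t, ht⟩ := isCompact_univ.elim_finite_subcover (fun y => {z | g y z ≠ 0})
    (fun y => (g y).isLocallyConstant {c | c ≠ 0}) (fun y _ => Set.mem_iUnion.mpr ⟨y, hg y⟩)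
  -- Each factor is the indicator function of the zero locus of `g y`; no point lies in all of them.
  have hprod : ∏ y ∈ t, (1 - g y ^ (p - 1)) = 0 := by
    ext z
    obtain ⟨y, hyt, hyz⟩ := Set.mem_iUnion₂.mp (ht (Set.mem_univ z))
    rw [← LocallyConstant.evalRingHom_apply z, map_prod, Finset.prod_eq_zero hyt]
    · rfl
    · rw [map_sub, map_one, map_pow, LocallyConstant.evalRingHom_apply,
        ZMod.pow_card_sub_one_eq_one hyz, sub_self]
  -- But `φ` sends every factor to `1`.
  have h1 := congrArg φ hprod
  simp [hφg, Nat.sub_ne_zero_of_lt hp.out.one_lt] at h1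

variable [CompactSpace Y] [T2Space Y] [TotallyDisconnectedSpace Y]

/-- Continuous maps to `Y` are separated by pullback, as clopen subsets separate points of `Y`. -/
theorem locallyConstant_comap_injective :
    Function.Injective fun f : C(X, Y) => LocallyConstant.comapₐ (Z := ZMod p) (ZMod p) f := by
  intro f g h
  ext x
  by_contra hne
  obtain ⟨U, hU, hfU, hgU⟩ := exists_isClopen_of_totally_separated hne
  have h1 := LocallyConstant.congr_fun
    (AlgHom.congr_fun h (LocallyConstant.charFn (ZMod p) hU)) x
  exact hgU ((LocallyConstant.charFn_eq_one (ZMod p) _ hU).mp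
    (h1.symm.trans ((LocallyConstant.charFn_eq_one (ZMod p) _ hU).mpr hfU)))

/-- Every algebra homomorphism `φ` between algebras of locally constant functions is the pullback
along a continuous map, which sends `x` to the point representing the character `f ↦ φ f x`. -/
theorem locallyConstant_comap_surjective :
    Function.Surjective fun f : C(X, Y) => LocallyConstant.comapₐ (Z := ZMod p) (ZMod p) f := by
  intro φ
  have h (x : X) := exists_forall_apply_eq_eval ((LocallyConstant.evalₐ (ZMod p) x).comp φ)
  choose f hf using h
  replace hf : ∀ x g, φ g x = g (f x) := hf
  have hcont : Continuous f := by
    refine isTopologicalBasis_isClopen.continuous_iff.mpr fun U hU => ?_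
    -- Clopen sets are detected by their characteristic functions, on which `f` acts through `φ`.
    have hpre : f ⁻¹' U = {x | φ (LocallyConstant.charFn (ZMod p) hU) x = 1} := by
      ext x
      rw [Set.mem_ofPred_eq, hf, LocallyConstant.charFn_eq_one, Set.mem_preimage]
    rw [hpre]
    exact (LocallyConstant.isLocallyConstant _).isOpen_fiber 1
  exact ⟨⟨f, hcont⟩, AlgHom.ext fun g => LocallyConstant.ext fun x => (hf x g).symm⟩

end LocallyConstant

/-! ### The equivalences of categories -/

/-- The functor sending a profinite set `X` to the `p`-Boolean algebra of locally constant
functions `X → 𝔽_p`. -/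
def locallyConstantFunctor (p : ℕ) [Fact p.Prime] : Profinite.{u}ᵒᵖ ⥤ PBoolCat.{u} p where
  obj X :=
    { obj := CommAlgCat.of (ZMod p) (LocallyConstant X.unop (ZMod p))
      property := locallyConstant_pow_eq_self }
  map f := ObjectProperty.homMk
    (CommAlgCat.ofHom (LocallyConstant.comapₐ (ZMod p) f.unop.hom.hom))

instance (p : ℕ) [Fact p.Prime] : (locallyConstantFunctor.{u} p).Faithful where
  map_injective {X Y} f g h := by
    apply Quiver.Hom.unop_inj
    apply ConcreteCategory.hom_ext
    have h1 : LocallyConstant.comapₐ (Z := ZMod p) (ZMod p) f.unop.hom.hom =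
        LocallyConstant.comapₐ (ZMod p) g.unop.hom.hom :=
      congrArg (fun k => k.hom.hom) h
    exact fun x => DFunLike.congr_fun (locallyConstant_comap_injective h1) x

instance (p : ℕ) [Fact p.Prime] : (locallyConstantFunctor.{u} p).Full where
  map_surjective {X Y} φ := by
    obtain ⟨f, hf⟩ := locallyConstant_comap_surjective (X := Y.unop) (Y := X.unop) φ.hom.hom
    refine ⟨(CompHausLike.ofHom _ f).op, ?_⟩
    apply ObjectProperty.hom_ext
    exact CommAlgCat.hom_ext hf

instance (p : ℕ) [Fact p.Prime] : (locallyConstantFunctor.{u} p).EssSurj where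
  mem_essImage R :=
    ⟨.op (Profinite.of (CharSpace p R.obj)), ⟨ObjectProperty.isoMk _ (CommAlgCat.isoMk
      (AlgEquiv.ofBijective (CharSpace.gelfand p R.obj)
        ⟨CharSpace.gelfand_injective R.property,
          CharSpace.gelfand_surjective R.property⟩).symm)⟩⟩

instance (p : ℕ) [Fact p.Prime] : (locallyConstantFunctor.{u} p).IsEquivalence where

end StoneDelta

theorem mainTheorem1 (p : ℕ) [Fact p.Prime] :
    Nonempty ((StoneDelta.StoneDeltaRingCat.{u} p)ᵒᵖ ≌ Profinite.{u}) := by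
  let W := (StoneDelta.PBoolCat.toPerfAlgCat.{u} p ⋙ StoneDelta.wittFunctor.{u} p).toEssImage
  have : W.IsEquivalence := { }
  let e : Profinite.{u}ᵒᵖ ≌ StoneDelta.StoneDeltaRingCat.{u} p :=
    (StoneDelta.locallyConstantFunctor.{u} p).asEquivalence.trans W.asEquivalence
  exact ⟨e.symm.op.trans (opOpEquivalence Profinite.{u})⟩
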